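/- For a field $K$ and a directed graph $E=(E^0,E^1,r,s)$, the Leavitt path algebra $L=L_K(E)$ is the associative (not necessarily unital) $K$-algebra generated by $E^0\cup E^1\cup (E^1)^*$ subject to $vv'=\delta_{v,v'}v$; $s(e)e=er(e)=e$; $r(e)e^*=e^*s(e)=e^*$; $e^*f=\delta_{e,f}r(e)$ for all $v,v'\in E^0$ and $e,f\in E^1$; and $v=\sum_{s(e)=v}ee^*$ for every vertex $v$ that emits at least one and only finitely many edges. The standard involution ${}^\star$ of $L$ is the $K$-linear anti-automorphism with $v^\star=v$, $e^\star=e^*$, $(e^*)^\star=e$. Put $\mathbf K_L=\{x\in L: x^\star=-x\}$, and let $[\mathbf K_L,\mathbf K_L]$ be the $K$-subspace of $L$ spanned by all $ab-ba$ with $a,b\in\mathbf K_L$. A ring is called simple if it is nonzero and its only two-sided ideals are $0$ and itself. A $K$-algebra is called locally finite if each of its finite subsets generates a finite-dimensional (not necessarily unital) subalgebra. **Proposition 3.11.** There is a Leavitt path algebra $L$ that is simple and locally finite and satisfies $\mathbf K_L\neq[\mathbf K_L,\mathbf K_L]$. Explicitly, let $K$ be any field of characteristic $2$ and let $A_{\mathbb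 Z}$ be the graph with vertices $v_i$ $(i\in\mathbb Z)$ and exactly one edge from $v_i$ to $v_{i+1}$ for each $i\in\mathbb Z$, and no other edges. Then $L=L_K(A_{\mathbb Z})$ is simple and locally finite, every vertex $v_i$ lies in $\mathbf K_L$ but not in $[\mathbf K_L,\mathbf K_L]$, and in particular $\mathbf K_L\neq[\mathbf K_L,\mathbf K_L]$. -/

import Mathlib

universe u v w

/-- A directed graph `(E⁰, E¹, r, s)` with vertex type `V` and edge type `Edge`. -/
structure DirectedGraph (V : Type u) (Edge : Type v) where
  /-- the source map -/
  s : Edge → V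
  /-- the range map -/
  r : Edge → V

/-- The generating set `E⁰ ∪ E¹ ∪ (E¹)*` (a disjoint union). -/
inductive LeavittGen (V : Type u) (Edge : Type v) : Type (max u v)
  | vertex : V → LeavittGen V Edge
  | edge : Edge → LeavittGen V Edge
  | ghost : Edge → LeavittGen V Edge

/-- The free associative (non-unital) `K`-algebra on a set `X`: the algebra of the free semigroup
on `X`, whose basis is the set of nonempty words in `X`. -/
abbrev FreeAssocAlgebra (K : Type w) [Field K] (X : Type u) : Type (max u w) :=
  MonoidAlgebra K (FreeSemigroup X)

/-- The image of a generator in the free associative algebra. -/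
noncomputable def FreeAssocAlgebra.of (K : Type w) [Field K] {X : Type u} (x : X) :
    FreeAssocAlgebra K X :=
  MonoidAlgebra.ofMagma K (FreeSemigroup X) (FreeSemigroup.of x)

/-- For a family `f` of elements of a non-unital ring indexed by the vertices, edges and ghost
edges of `G`, the pairs `(lhs, rhs)` of the defining relations (V), (E1), (E2), (CK1), (CK2). -/
inductive LeavittRel {V : Type u} {Edge : Type v} (G : DirectedGraph V Edge)
    {A : Type w} [NonUnitalRing A] (f : LeavittGen V Edge → A) : A → A → Prop
  | v_same (x : V) : LeavittRel G f (f (.vertex x) * f (.vertex x)) (f (.vertex x))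
  | v_ne (x y : V) (h : x ≠ y) : LeavittRel G f (f (.vertex x) * f (.vertex y)) 0
  | e1_source (e : Edge) : LeavittRel G f (f (.vertex (G.s e)) * f (.edge e)) (f (.edge e))
  | e1_range (e : Edge) : LeavittRel G f (f (.edge e) * f (.vertex (G.r e))) (f (.edge e))
  | e2_range (e : Edge) : LeavittRel G f (f (.vertex (G.r e)) * f (.ghost e)) (f (.ghost e))
  | e2_source (e : Edge) : LeavittRel G f (f (.ghost e) * f (.vertex (G.s e))) (f (.ghost e))
  | ck1_same (e : Edge) : LeavittRel G f (f (.ghost e) * f (.edge e)) (f (.vertex (G.r e)))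
  | ck1_ne (e e' : Edge) (h : e ≠ e') : LeavittRel G f (f (.ghost e) * f (.edge e')) 0
  /- the vertex `x` is regular: it emits finitely many edges, and at least one -/
  | ck2 (x : V) (hfin : {e : Edge | G.s e = x}.Finite) (hne : {e : Edge | G.s e = x}.Nonempty) :
      LeavittRel G f (f (.vertex x)) (∑ e ∈ hfin.toFinset, f (.edge e) * f (.ghost e))

/-- The smallest `K`-algebra congruence on the free associative algebra identifying both sides of
each defining relation. Scalar multiples of the relations are included among the generators because
the free algebra has no unit. -/
noncomputable def leavittCon (K : Type w) [Field K] {V : Type u} {Edge : Type v}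
    (G : DirectedGraph V Edge) : RingCon (FreeAssocAlgebra K (LeavittGen V Edge)) :=
  ringConGen fun a b => ∃ (k : K) (x y : FreeAssocAlgebra K (LeavittGen V Edge)),
    LeavittRel G (FreeAssocAlgebra.of K) x y ∧ a = k • x ∧ b = k • y

theorem leavittCon_smul (K : Type w) [Field K] {V : Type u} {Edge : Type v}
    (G : DirectedGraph V Edge) (k : K) {a b : FreeAssocAlgebra K (LeavittGen V Edge)}
    (h : leavittCon K G a b) : leavittCon K G (k • a) (k • b) := by
  suffices H : ∀ k : K, leavittCon K G (k • a) (k • b) from H k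
  change RingConGen.Rel _ a b at h
  induction h with
  | of x y h =>
    obtain ⟨k', x', y', hr, rfl, rfl⟩ := h
    exact fun k => RingConGen.Rel.of _ _ ⟨k * k', x', y', hr, (mul_smul ..).symm, (mul_smul ..).symm⟩
  | refl x => exact fun k => (leavittCon K G).refl _
  | symm _ ih => exact fun k => (leavittCon K G).symm (ih k)
  | trans _ _ ih₁ ih₂ => exact fun k => (leavittCon K G).trans (ih₁ k) (ih₂ k)
  | add _ _ ih₁ ih₂ =>
    intro k
    rw [smul_add, smul_add]
    exact (leavittCon K G).add (ih₁ k) (ih₂ k)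
  | mul _ h₂ ih₁ _ =>
    intro k
    rw [← smul_mul_assoc, ← smul_mul_assoc]
    exact (leavittCon K G).mul (ih₁ k) h₂

/-- The Leavitt path algebra `L_K(E)`, an associative, not necessarily unital `K`-algebra. -/
def LeavittPathAlgebra (K : Type w) [Field K] {V : Type u} {Edge : Type v}
    (G : DirectedGraph V Edge) : Type (max u v w) :=
  (leavittCon K G).Quotient

namespace LeavittPathAlgebra

variable {K : Type w} [Field K] {V : Type u} {Edge : Type v} {G : DirectedGraph V Edge}

noncomputable instance : NonUnitalRing (LeavittPathAlgebra K G) :=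
  inferInstanceAs (NonUnitalRing (leavittCon K G).Quotient)

variable (K G) in
/-- The quotient map from the free algebra. -/
noncomputable def proj (a : FreeAssocAlgebra K (LeavittGen V Edge)) : LeavittPathAlgebra K G :=
  RingCon.toQuotient (c := leavittCon K G) a

theorem proj_surjective : Function.Surjective (proj K G) := Quotient.mk''_surjective

theorem proj_add (a b : FreeAssocAlgebra K (LeavittGen V Edge)) :
    proj K G (a + b) = proj K G a + proj K G b := rfl

theorem proj_mul (a b : FreeAssocAlgebra K (LeavittGen V Edge)) :
    proj K G (a * b) = proj K G a * proj K G b := rfl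

theorem proj_zero : proj K G 0 = 0 := rfl

noncomputable instance : SMul K (LeavittPathAlgebra K G) where
  smul k := Quotient.map' (fun a => k • a) fun _ _ h => leavittCon_smul K G k h

theorem proj_smul (k : K) (a : FreeAssocAlgebra K (LeavittGen V Edge)) :
    proj K G (k • a) = k • proj K G a := rfl

noncomputable instance : Module K (LeavittPathAlgebra K G) :=
  Function.Surjective.module K
    ({ toFun := proj K G, map_zero' := proj_zero, map_add' := proj_add } :
      FreeAssocAlgebra K (LeavittGen V Edge) →+ LeavittPathAlgebra K G)
    proj_surjective proj_smul

instance : IsScalarTower K (LeavittPathAlgebra K G) (LeavittPathAlgebra K G) where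
  smul_assoc k x y := by
    obtain ⟨a, rfl⟩ := proj_surjective x
    obtain ⟨b, rfl⟩ := proj_surjective y
    rw [smul_eq_mul, smul_eq_mul, ← proj_smul, ← proj_mul, ← proj_mul, ← proj_smul, smul_mul_assoc]

instance : SMulCommClass K (LeavittPathAlgebra K G) (LeavittPathAlgebra K G) where
  smul_comm k x y := by
    obtain ⟨a, rfl⟩ := proj_surjective x
    obtain ⟨b, rfl⟩ := proj_surjective y
    rw [smul_eq_mul, smul_eq_mul, ← proj_smul, ← proj_mul, ← proj_mul, ← proj_smul, mul_smul_comm]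

variable (K G) in
/-- The image of a generator in `L_K(E)`. -/
noncomputable def gen (x : LeavittGen V Edge) : LeavittPathAlgebra K G :=
  proj K G (FreeAssocAlgebra.of K x)

variable (K G) in
/-- A vertex, viewed as an element of `L_K(E)`. -/
noncomputable def vertex (x : V) : LeavittPathAlgebra K G := gen K G (.vertex x)

variable (K G) in
/-- The quotient map as a homomorphism of non-unital `K`-algebras. -/
noncomputable def projHom : FreeAssocAlgebra K (LeavittGen V Edge) →ₙₐ[K] LeavittPathAlgebra K G where
  toFun := proj K G
  map_smul' := proj_smul
  map_zero' := proj_zero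
  map_add' := proj_add
  map_mul' := proj_mul

/-- The generators satisfy the defining relations. -/
theorem gen_rel {x y : LeavittPathAlgebra K G} (h : LeavittRel G (gen K G) x y) : x = y := by
  have key : ∀ a b : FreeAssocAlgebra K (LeavittGen V Edge),
      LeavittRel G (FreeAssocAlgebra.of K) a b → proj K G a = proj K G b := fun a b hab =>
    Quotient.sound' (RingConGen.Rel.of _ _ ⟨1, a, b, hab, (one_smul ..).symm, (one_smul ..).symm⟩)
  cases h with
  | v_same x => exact key _ _ (.v_same x)
  | v_ne x y h => exact key _ _ (.v_ne x y h)
  | e1_source e => exact key _ _ (.e1_source e)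
  | e1_range e => exact key _ _ (.e1_range e)
  | e2_range e => exact key _ _ (.e2_range e)
  | e2_source e => exact key _ _ (.e2_source e)
  | ck1_same e => exact key _ _ (.ck1_same e)
  | ck1_ne e e' h => exact key _ _ (.ck1_ne e e' h)
  | ck2 x hfin hne =>
    refine (key _ _ (.ck2 x hfin hne)).trans ?_
    exact map_sum (projHom K G) _ _

section lift

variable {B : Type*} [NonUnitalRing B] [Module K B] [IsScalarTower K B B] [SMulCommClass K B B]

/-- The homomorphism on the free algebra determined by the images of the generators. -/
noncomputable def freeLift (f : LeavittGen V Edge → B) :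
    FreeAssocAlgebra K (LeavittGen V Edge) →ₙₐ[K] B :=
  MonoidAlgebra.liftMagma K (FreeSemigroup.lift f)

theorem freeLift_of (f : LeavittGen V Edge → B) (x : LeavittGen V Edge) :
    freeLift (K := K) f (FreeAssocAlgebra.of K x) = f x := by
  simp [freeLift, FreeAssocAlgebra.of]

theorem freeLift_rel {f : LeavittGen V Edge → B}
    (hf : ∀ x y, LeavittRel G f x y → x = y) {a b : FreeAssocAlgebra K (LeavittGen V Edge)}
    (h : leavittCon K G a b) : freeLift (K := K) f a = freeLift (K := K) f b := by
  change RingConGen.Rel _ a b at h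
  induction h with
  | of x y h =>
    obtain ⟨k, x', y', hr, rfl, rfl⟩ := h
    rw [map_smul, map_smul]
    congr 1
    cases hr <;> simp only [map_mul, map_sum, map_zero, freeLift_of] <;> apply hf
    · exact .v_same _
    · exact .v_ne _ _ ‹_›
    · exact .e1_source _
    · exact .e1_range _
    · exact .e2_range _
    · exact .e2_source _
    · exact .ck1_same _
    · exact .ck1_ne _ _ ‹_›
    · exact .ck2 _ _ ‹_›
  | refl x => rfl
  | symm _ ih => exact ih.symm
  | trans _ _ ih₁ ih₂ => exact ih₁.trans ih₂
  | add _ _ ih₁ ih₂ => rw [map_add, map_add, ih₁, ih₂]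
  | mul _ _ ih₁ ih₂ => rw [map_mul, map_mul, ih₁, ih₂]

/-- Universal property: a family satisfying the defining relations extends to `L_K(E)`. -/
noncomputable def lift (f : LeavittGen V Edge → B) (hf : ∀ x y, LeavittRel G f x y → x = y) :
    LeavittPathAlgebra K G →ₙₐ[K] B where
  toFun := Quotient.lift (fun a => freeLift (K := K) f a) fun _ _ h => freeLift_rel hf h
  map_smul' k x := by
    obtain ⟨a, rfl⟩ := proj_surjective x
    exact map_smul (freeLift (K := K) f) k a
  map_zero' := map_zero (freeLift (K := K) f)
  map_add' x y := by
    obtain ⟨a, rfl⟩ := proj_surjective x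
    obtain ⟨b, rfl⟩ := proj_surjective y
    exact map_add (freeLift (K := K) f) a b
  map_mul' x y := by
    obtain ⟨a, rfl⟩ := proj_surjective x
    obtain ⟨b, rfl⟩ := proj_surjective y
    exact map_mul (freeLift (K := K) f) a b

theorem lift_gen (f : LeavittGen V Edge → B) (hf : ∀ x y, LeavittRel G f x y → x = y)
    (x : LeavittGen V Edge) : lift (K := K) f hf (gen K G x) = f x :=
  freeLift_of f x

theorem hom_ext {φ ψ : LeavittPathAlgebra K G →ₙₐ[K] B}
    (h : ∀ x, φ (gen K G x) = ψ (gen K G x)) : φ = ψ := by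
  have key : φ.comp (projHom K G) = ψ.comp (projHom K G) := by
    apply (MonoidAlgebra.liftMagma K).symm.injective
    apply FreeSemigroup.hom_ext
    funext x
    exact h x
  ext x
  obtain ⟨a, rfl⟩ := proj_surjective x
  exact DFunLike.congr_fun key a

end lift

/-- The effect of the standard involution on generators: `v ↦ v`, `e ↦ e*`, `e* ↦ e`. -/
def starGen : LeavittGen V Edge → LeavittGen V Edge
  | .vertex x => .vertex x
  | .edge e => .ghost e
  | .ghost e => .edge e

theorem starGen_rel (x y : (LeavittPathAlgebra K G)ᵐᵒᵖ)
    (h : LeavittRel G (fun g => MulOpposite.op (gen K G (starGen g))) x y) : x = y := by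
  cases h <;> apply MulOpposite.unop_injective
  · exact gen_rel (.v_same _)
  · exact gen_rel (.v_ne _ _ (Ne.symm ‹_›))
  · exact gen_rel (.e2_source _)
  · exact gen_rel (.e2_range _)
  · exact gen_rel (.e1_range _)
  · exact gen_rel (.e1_source _)
  · exact gen_rel (.ck1_same _)
  · exact gen_rel (.ck1_ne _ _ (Ne.symm ‹_›))
  · change gen K G _ = MulOpposite.opAddEquiv.symm _
    rw [map_sum]
    exact gen_rel (.ck2 _ _ ‹_›)

variable (K G) in
/-- The standard involution, as a `K`-algebra homomorphism to the opposite algebra. -/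
noncomputable def starHom : LeavittPathAlgebra K G →ₙₐ[K] (LeavittPathAlgebra K G)ᵐᵒᵖ :=
  lift (fun g => MulOpposite.op (gen K G (starGen g))) starGen_rel

noncomputable instance : Star (LeavittPathAlgebra K G) where
  star x := (starHom K G x).unop

theorem star_def (x : LeavittPathAlgebra K G) : star x = (starHom K G x).unop := rfl

theorem star_gen (g : LeavittGen V Edge) : star (gen K G g) = gen K G (starGen g) := by
  rw [star_def, starHom, lift_gen, MulOpposite.unop_op]

/-- The standard involution fixes the scalars. -/
theorem star_smul_eq (k : K) (x : LeavittPathAlgebra K G) : star (k • x) = k • star x := by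
  rw [star_def, map_smul, MulOpposite.unop_smul, star_def]

variable (K G) in
/-- The standard involution applied twice. -/
noncomputable def starStarHom : LeavittPathAlgebra K G →ₙₐ[K] LeavittPathAlgebra K G where
  toFun x := star (star x)
  map_smul' k x := by simp [star_smul_eq]
  map_zero' := by simp [star_def]
  map_add' x y := by simp [star_def]
  map_mul' x y := by simp [star_def]

/-- The standard involution of `L_K(E)`. -/
noncomputable instance : StarRing (LeavittPathAlgebra K G) where
  star_involutive x := by
    have h : starStarHom K G = NonUnitalAlgHom.id K (LeavittPathAlgebra K G) := by
      apply hom_ext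
      intro g
      change star (star (gen K G g)) = gen K G g
      rw [star_gen, star_gen]
      cases g <;> rfl
    exact DFunLike.congr_fun h x
  star_mul x y := by simp [star_def]
  star_add x y := by simp [star_def]

end LeavittPathAlgebra

/-- `[I, I]`: the `K`-subspace spanned by all commutators `a * b - b * a` with `a, b ∈ I`. -/
def commutatorSpan (K : Type w) [Field K] {A : Type u} [NonUnitalRing A] [Module K A]
    (I : Set A) : Submodule K A :=
  Submodule.span K {x : A | ∃ a ∈ I, ∃ b ∈ I, x = a * b - b * a}

/-- A (not necessarily unital) `K`-algebra is locally finite if each finite subset generates a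
finite-dimensional (not necessarily unital) subalgebra. -/
def IsLocallyFiniteAlgebra (K : Type w) [Field K] (A : Type u) [NonUnitalRing A] [Module K A]
    [IsScalarTower K A A] [SMulCommClass K A A] : Prop :=
  ∀ F : Finset A, FiniteDimensional K (NonUnitalAlgebra.adjoin K (F : Set A))

/-- The two-sided infinite line graph `A_ℤ`: vertices `v i` for `i ∈ ℤ`, and for each `i` exactly
one edge from `v i` to `v (i + 1)`. -/
def lineGraphZ : DirectedGraph ℤ ℤ where
  s i := i
  r i := i + 1

/-! In the double graph of `A_ℤ` (edges and ghost edges) fix the path p_i from 0 to i. Since each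
vertex emits one edge and receives one edge, (CK1) and (CK2) give p_i p_i* = v_0 and p_i* p_i = v_i
(`linePath_spec`). Hence the elements p_i* p_j are matrix units; they span L, and the involution
transposes them. So L is the algebra of finitary ℤ × ℤ matrices, with v_i on the diagonal.
Simplicity and local finiteness hold for any span of matrix units, given one nonzero unit for
simplicity (`isSimpleRing`, `isLocallyFiniteAlgebra`).

For skew a and b one has (ab)* = ba, so ab - ba = ab - (ab)*. Its diagonal vanishes, because
transposition fixes diagonal entries (`lineDiag_star`), whereas v_i has diagonal entry 1.
Characteristic 2 serves only to make the self-adjoint v_i skew. That the v_i do not collapse to 0 is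
seen in the representation `lineRep`. -/

/-! ### Algebras spanned by matrix units -/

section MatrixUnits

variable {K : Type w} [Field K] {A : Type u} [NonUnitalRing A] [Module K A]

/-- A family of matrix units in a not necessarily unital ring. -/
structure IsMatrixUnits {A : Type u} [NonUnitalRing A] {ι : Type v} (m : ι → ι → A) : Prop where
  mul_same (i j k : ι) : m i j * m j k = m i k
  mul_ne (i j k l : ι) (h : j ≠ k) : m i j * m k l = 0

/-- A family of matrix units spanning a (not necessarily unital) algebra. -/
structure IsSpanningMatrixUnits (K : Type w) [Field K] {A : Type u} [NonUnitalRing A] [Module K A]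
    {ι : Type v} (m : ι → ι → A) : Prop extends IsMatrixUnits m where
  span_eq_top : Submodule.span K (Set.range fun p : ι × ι => m p.1 p.2) = ⊤

/-- The subalgebra spanned by the matrix units with indices in `S`. -/
def IsMatrixUnits.blockSubalgebra (K : Type w) [Field K] {A : Type u} [NonUnitalRing A]
    [Module K A] [IsScalarTower K A A] [SMulCommClass K A A] {ι : Type v} {m : ι → ι → A}
    (hm : IsMatrixUnits m) (S : Set ι) : NonUnitalSubalgebra K A where
  __ := Submodule.span K ((fun p : ι × ι => m p.1 p.2) '' S ×ˢ S)
  mul_mem' {x y} hx hy := by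
    refine Submodule.span_induction₂ (p := fun x y _ _ =>
      x * y ∈ Submodule.span K ((fun p : ι × ι => m p.1 p.2) '' S ×ˢ S))
      ?_ ?_ ?_ ?_ ?_ ?_ ?_ hx hy
    · rintro _ _ ⟨⟨i, j⟩, ⟨hi, hj⟩, rfl⟩ ⟨⟨k, l⟩, ⟨hk, hl⟩, rfl⟩
      by_cases hjk : j = k
      · subst hjk
        change m i j * m j l ∈ _
        rw [hm.mul_same]
        exact Submodule.subset_span ⟨(i, l), ⟨hi, hl⟩, rfl⟩
      · change m i j * m k l ∈ _
        rw [hm.mul_ne _ _ _ _ hjk]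
        exact zero_mem _
    · intro y _; rw [zero_mul]; exact zero_mem _
    · intro x _; rw [mul_zero]; exact zero_mem _
    · intro x y z _ _ _ h₁ h₂; rw [add_mul]; exact add_mem h₁ h₂
    · intro x y z _ _ _ h₁ h₂; rw [mul_add]; exact add_mem h₁ h₂
    · intro k x y _ _ h; rw [smul_mul_assoc]; exact Submodule.smul_mem _ _ h
    · intro k x y _ _ h; rw [mul_smul_comm]; exact Submodule.smul_mem _ _ h

namespace IsSpanningMatrixUnits

variable {ι : Type v} {m : ι → ι → A}

theorem exists_sum (hm : IsSpanningMatrixUnits K m) (x : A) :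
    ∃ c : ι × ι →₀ K, x = c.sum fun p k => k • m p.1 p.2 := by
  have hx : x ∈ Submodule.span K (Set.range fun p : ι × ι => m p.1 p.2) :=
    hm.span_eq_top ▸ Submodule.mem_top
  obtain ⟨c, hc⟩ := Finsupp.mem_span_range_iff_exists_finsupp.1 hx
  exact ⟨c, hc.symm⟩

variable [IsScalarTower K A A] [SMulCommClass K A A]

/-- The left factor kills every row but a, the right factor every column but b. This isolates a
single coefficient. -/
theorem corner_sum (hm : IsSpanningMatrixUnits K m) (c : ι × ι →₀ K) (a b : ι) :
    m a a * (c.sum fun p k => k • m p.1 p.2) * m b b = c (a, b) • m a b := by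
  classical
  rw [Finsupp.sum, Finset.mul_sum, Finset.sum_mul, Finset.sum_eq_single (a, b)]
  · rw [mul_smul_comm, smul_mul_assoc, hm.mul_same, hm.mul_same]
  · rintro ⟨i, j⟩ - hij
    rw [mul_smul_comm, smul_mul_assoc]
    by_cases hi : a = i
    · have hj : j ≠ b := fun hj => hij (by rw [hi, hj])
      subst hi
      rw [hm.mul_same, hm.mul_ne _ _ _ _ hj, smul_zero]
    · rw [hm.mul_ne _ _ _ _ hi, zero_mul, smul_zero]
  · intro h
    rw [Finsupp.notMem_support_iff.1 h, zero_smul, mul_zero, zero_mul]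

theorem exists_corner (hm : IsSpanningMatrixUnits K m) (x : A) (a b : ι) :
    ∃ k : K, m a a * x * m b b = k • m a b := by
  obtain ⟨c, rfl⟩ := hm.exists_sum x
  exact ⟨_, hm.corner_sum c a b⟩

/-- Cutting a nonzero element of an ideal down to a corner leaves a nonzero multiple of one unit,
from which multiplication on both sides reaches all others. -/
theorem isSimpleRing (hm : IsSpanningMatrixUnits K m) {i₀ : ι} (h0 : m i₀ i₀ ≠ 0) :
    IsSimpleRing A := by
  have hnt : Nontrivial (TwoSidedIdeal A) := by
    refine ⟨⊥, ⊤, fun h => h0 ?_⟩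
    rw [← TwoSidedIdeal.mem_bot, h]
    exact TwoSidedIdeal.mem_top A
  refine ⟨⟨fun I => or_iff_not_imp_left.2 fun hI => ?_⟩⟩
  obtain ⟨x, hxI, hx0⟩ : ∃ x ∈ I, x ≠ 0 := by
    by_contra! h
    exact hI (le_antisymm (fun x hx => (TwoSidedIdeal.mem_bot A).2 (h x hx)) bot_le)
  obtain ⟨c, rfl⟩ := hm.exists_sum x
  obtain ⟨⟨a, b⟩, hab⟩ : ∃ p, c p ≠ 0 := by
    by_contra! h
    exact hx0 (by simp [Finsupp.ext (g := 0) h])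
  have hcorner : c (a, b) • m a b ∈ I := by
    rw [← hm.corner_sum c a b]
    exact I.mul_mem_right _ _ (I.mul_mem_left _ _ hxI)
  have hsmul (k : K) (i j : ι) : k • m i j ∈ I := by
    -- A ring ideal is not assumed closed under scalars, so the scalar is absorbed into the left
    -- factor, an element of `A`.
    have : k • m i j = (k * (c (a, b))⁻¹) • m i a * (c (a, b) • m a b) * m b j := by
      rw [smul_mul_smul_comm, smul_mul_assoc, hm.mul_same, hm.mul_same, mul_assoc,
        inv_mul_cancel₀ hab, mul_one]
    rw [this]
    exact I.mul_mem_right _ _ (I.mul_mem_left _ _ hcorner)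
  refine le_antisymm le_top fun y _ => ?_
  obtain ⟨d, rfl⟩ := hm.exists_sum y
  exact sum_mem fun p _ => hsmul _ _ _

theorem isLocallyFiniteAlgebra (hm : IsSpanningMatrixUnits K m) : IsLocallyFiniteAlgebra K A := by
  classical
  intro F
  choose c hc using hm.exists_sum
  -- All row and column indices occurring in the chosen expansions; the block on them is
  -- finite-dimensional and contains `F`.
  let S : Finset ι := F.biUnion fun x => (c x).support.image Prod.fst ∪ (c x).support.image Prod.snd
  have hle : NonUnitalAlgebra.adjoin K (F : Set A) ≤ hm.toIsMatrixUnits.blockSubalgebra K S := by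
    refine NonUnitalAlgebra.adjoin_le fun x hx => ?_
    rw [hc x]
    refine sum_mem fun p hp => Submodule.smul_mem
      (hm.toIsMatrixUnits.blockSubalgebra K S).toSubmodule _ (Submodule.subset_span ?_)
    refine ⟨p, ⟨?_, ?_⟩, rfl⟩
    · exact Finset.mem_biUnion.2 ⟨x, hx, Finset.mem_union_left _ (Finset.mem_image_of_mem _ hp)⟩
    · exact Finset.mem_biUnion.2 ⟨x, hx, Finset.mem_union_right _ (Finset.mem_image_of_mem _ hp)⟩
  have : FiniteDimensional K (Submodule.span K ((fun p : ι × ι => m p.1 p.2) '' (S : Set ι) ×ˢ S)) :=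
    FiniteDimensional.span_of_finite K ((S.finite_toSet.prod S.finite_toSet).image _)
  exact Submodule.finiteDimensional_of_le
    (S₁ := (NonUnitalAlgebra.adjoin K (F : Set A)).toSubmodule)
    (S₂ := Submodule.span K ((fun p : ι × ι => m p.1 p.2) '' (S : Set ι) ×ˢ S)) hle

end IsSpanningMatrixUnits

end MatrixUnits

namespace LeavittPathAlgebra

/-! ### Generation by vertices, edges and ghost edges -/

section Generation

variable {K : Type w} [Field K] {V : Type u} {Edge : Type v} {G : DirectedGraph V Edge}

/-- A subalgebra of `L_K(E)` containing the generators is the whole algebra. -/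
theorem mem_of_gen_mem (S : NonUnitalSubalgebra K (LeavittPathAlgebra K G))
    (h : ∀ g, gen K G g ∈ S) (x : LeavittPathAlgebra K G) : x ∈ S := by
  obtain ⟨a, rfl⟩ := proj_surjective x
  have hword (t : FreeSemigroup (LeavittGen V Edge)) :
      proj K G (MonoidAlgebra.ofMagma K _ t) ∈ S := by
    induction t using FreeSemigroup.recOnMul with
    | ih1 g => exact h g
    | ih2 g t hg ht =>
      rw [map_mul, proj_mul]
      exact mul_mem hg ht
  induction a using MonoidAlgebra.induction_linear with
  | zero => exact zero_mem S
  | add a b ha hb => exact add_mem ha hb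
  | single t k =>
    have : MonoidAlgebra.single t k = k • MonoidAlgebra.ofMagma K _ t := by
      simp
    rw [this, proj_smul]
    exact Submodule.smul_mem S.toSubmodule k (hword t)

theorem star_vertex (i : V) : star (vertex K G i) = vertex K G i :=
  star_gen _

end Generation

/-! ### Matrix units in the Leavitt path algebra of the line -/

section Line

variable (K : Type w) [Field K]

local notation "L" => LeavittPathAlgebra K lineGraphZ

/-- The edge from `i` to `i + 1` in `L_K(A_ℤ)`. -/
noncomputable def lineEdge (i : ℤ) : L := gen K lineGraphZ (.edge i)

local notation "vx" => vertex K lineGraphZ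

theorem star_lineEdge (i : ℤ) : star (lineEdge K i) = gen K lineGraphZ (.ghost i) :=
  star_gen _

theorem vertex_mul_self (i : ℤ) : vx i * vx i = vx i := gen_rel (.v_same i)

theorem vertex_mul_of_ne {i j : ℤ} (h : i ≠ j) : vx i * vx j = 0 := gen_rel (.v_ne i j h)

theorem lineEdge_mul_vertex (i : ℤ) : lineEdge K i * vx (i + 1) = lineEdge K i :=
  gen_rel (.e1_range i)

theorem vertex_mul_lineEdge (i : ℤ) : vx i * lineEdge K i = lineEdge K i :=
  gen_rel (.e1_source i)

theorem star_lineEdge_mul_vertex (i : ℤ) : star (lineEdge K i) * vx i = star (lineEdge K i) := by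
  rw [star_lineEdge]
  exact gen_rel (.e2_source i)

theorem star_lineEdge_mul_lineEdge (i : ℤ) : star (lineEdge K i) * lineEdge K i = vx (i + 1) := by
  rw [star_lineEdge]
  exact gen_rel (.ck1_same i)

theorem lineEdge_mul_star_lineEdge (i : ℤ) : lineEdge K i * star (lineEdge K i) = vx i := by
  rw [star_lineEdge]
  have hfin : {e : ℤ | lineGraphZ.s e = i}.Finite := Set.finite_singleton i
  have h := gen_rel (K := K) (.ck2 i hfin ⟨i, rfl⟩)
  have hs : hfin.toFinset = {i} := by ext e; simp [lineGraphZ]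
  rw [hs, Finset.sum_singleton] at h
  exact h.symm

/-- The path in the double graph of `A_ℤ` from the vertex `0` to the vertex `i`. -/
noncomputable def linePath : ℤ → L
  | .ofNat n => Nat.rec (vx 0) (fun k x => x * lineEdge K k) n
  | .negSucc n => Nat.rec (vx 0 * star (lineEdge K (-1)))
      (fun k x => x * star (lineEdge K (.negSucc (k + 1)))) n

theorem linePath_natCast_add_one (n : ℕ) :
    linePath K (n + 1 : ℕ) = linePath K n * lineEdge K n := rfl

theorem linePath_negSucc (n : ℕ) :
    linePath K (.negSucc n) = linePath K (.negSucc n + 1) * star (lineEdge K (.negSucc n)) := by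
  -- The index `.negSucc n + 1` reduces only once `n` is split: it is 0 for `n = 0` and negative
  -- otherwise.
  cases n <;> rfl

/-- Induction outwards from 0 in both directions: appending an edge or a ghost edge inserts e e* or
e* e, a vertex that the path already absorbs. -/
theorem linePath_spec (i : ℤ) :
    linePath K i * vx i = linePath K i ∧ linePath K i * star (linePath K i) = vx 0 ∧
      star (linePath K i) * linePath K i = vx i := by
  have step_pos {i : ℤ} {x : L} (h : x * vx i = x ∧ x * star x = vx 0 ∧ star x * x = vx i) :
      x * lineEdge K i * vx (i + 1) = x * lineEdge K i ∧
        x * lineEdge K i * star (x * lineEdge K i) = vx 0 ∧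
        star (x * lineEdge K i) * (x * lineEdge K i) = vx (i + 1) := by
    obtain ⟨h₁, h₂, h₃⟩ := h
    refine ⟨by rw [mul_assoc, lineEdge_mul_vertex], ?_, ?_⟩
    · rw [star_mul, ← mul_assoc, mul_assoc x, lineEdge_mul_star_lineEdge, h₁, h₂]
    · rw [star_mul, ← mul_assoc, mul_assoc _ (star x), h₃, mul_assoc, vertex_mul_lineEdge,
        star_lineEdge_mul_lineEdge]
  have step_neg {i : ℤ} {x : L}
      (h : x * vx (i + 1) = x ∧ x * star x = vx 0 ∧ star x * x = vx (i + 1)) :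
      x * star (lineEdge K i) * vx i = x * star (lineEdge K i) ∧
        x * star (lineEdge K i) * star (x * star (lineEdge K i)) = vx 0 ∧
        star (x * star (lineEdge K i)) * (x * star (lineEdge K i)) = vx i := by
    obtain ⟨h₁, h₂, h₃⟩ := h
    refine ⟨by rw [mul_assoc, star_lineEdge_mul_vertex], ?_, ?_⟩
    · rw [star_mul, star_star, ← mul_assoc, mul_assoc x, star_lineEdge_mul_lineEdge, h₁, h₂]
    · rw [star_mul, star_star, ← mul_assoc, mul_assoc _ (star x), h₃, lineEdge_mul_vertex,
        lineEdge_mul_star_lineEdge]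
  have h0 : vx 0 * vx 0 = vx 0 ∧ vx 0 * star (vx 0) = vx 0 ∧ star (vx 0) * vx 0 = vx 0 := by
    rw [star_vertex, vertex_mul_self]
    exact ⟨rfl, rfl, rfl⟩
  obtain n | n := i
  · induction n with
    | zero => exact h0
    | succ n ih => exact step_pos ih
  · induction n with
    | zero => exact step_neg (i := -1) h0
    | succ n ih =>
      rw [linePath_negSucc]
      exact step_neg ih

theorem linePath_add_one (i : ℤ) : linePath K (i + 1) = linePath K i * lineEdge K i := by
  obtain n | n := i
  · exact linePath_natCast_add_one K n
  -- To the left of 0 the new edge cancels the last ghost edge by (CK1).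
  · rw [linePath_negSucc K n, mul_assoc, star_lineEdge_mul_lineEdge, (linePath_spec K _).1]

/-- The matrix units of `L_K(A_ℤ)`. -/
noncomputable def lineUnit (i j : ℤ) : L := star (linePath K i) * linePath K j

theorem lineUnit_self (i : ℤ) : lineUnit K i i = vx i := (linePath_spec K i).2.2

theorem star_lineUnit (i j : ℤ) : star (lineUnit K i j) = lineUnit K j i := by
  rw [lineUnit, star_mul, star_star, lineUnit]

theorem lineUnit_add_one (i : ℤ) : lineUnit K i (i + 1) = lineEdge K i := by
  rw [lineUnit, linePath_add_one, ← mul_assoc, (linePath_spec K i).2.2, vertex_mul_lineEdge]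

theorem lineUnit_mul_same (i j k : ℤ) : lineUnit K i j * lineUnit K j k = lineUnit K i k := by
  have h := (linePath_spec K i).1
  have h0 : star (linePath K i) * vx 0 = star (linePath K i) := by
    rw [← (linePath_spec K i).2.1, ← mul_assoc, (linePath_spec K i).2.2,
      ← star_vertex (K := K) (G := lineGraphZ) i, ← star_mul, h]
  rw [lineUnit, lineUnit, mul_assoc, ← mul_assoc (linePath K j), (linePath_spec K j).2.1,
    ← mul_assoc, h0, lineUnit]

/-- The orthogonal vertices v_j and v_k can be inserted between the two factors. -/
theorem lineUnit_mul_of_ne (i j k l : ℤ) (h : j ≠ k) : lineUnit K i j * lineUnit K k l = 0 := by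
  rw [← lineUnit_mul_same K i j j, ← lineUnit_mul_same K k k l, lineUnit_self K j,
    lineUnit_self K k, mul_assoc, ← mul_assoc (vx j), vertex_mul_of_ne K h, zero_mul, mul_zero]

theorem isMatrixUnits_lineUnit : IsMatrixUnits (lineUnit K) where
  mul_same := lineUnit_mul_same K
  mul_ne := lineUnit_mul_of_ne K

theorem isSpanningMatrixUnits_lineUnit : IsSpanningMatrixUnits K (lineUnit K) where
  __ := isMatrixUnits_lineUnit K
  span_eq_top := by
    have hS (i j : ℤ) : lineUnit K i j ∈
        (isMatrixUnits_lineUnit K).blockSubalgebra K Set.univ :=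
      Submodule.subset_span ⟨(i, j), ⟨trivial, trivial⟩, rfl⟩
    -- This turns the span into the block on all indices, a subalgebra, so that only the generators
    -- need checking.
    rw [← Set.image_univ, ← Set.univ_prod_univ]
    refine Submodule.eq_top_iff'.2 (mem_of_gen_mem
      ((isMatrixUnits_lineUnit K).blockSubalgebra K Set.univ) ?_)
    rintro (i | i | i)
    · have h := hS i i
      rwa [lineUnit_self] at h
    · have h := hS i (i + 1)
      rwa [lineUnit_add_one] at h
    · have h := hS (i + 1) i
      rwa [← star_lineUnit, lineUnit_add_one, star_lineEdge] at h

/-! ### Matrix representation and diagonal entries -/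

/-- The images of the generators of `L_K(A_ℤ)` as elementary matrices. -/
noncomputable def lineRepGen : LeavittGen ℤ ℤ → Module.End K (ℤ →₀ K)
  | .vertex i => Finsupp.lsingle i ∘ₗ Finsupp.lapply i
  | .edge i => Finsupp.lsingle i ∘ₗ Finsupp.lapply (i + 1)
  | .ghost i => Finsupp.lsingle (i + 1) ∘ₗ Finsupp.lapply i

theorem lineRepGen_rel (x y : Module.End K (ℤ →₀ K))
    (h : LeavittRel lineGraphZ (lineRepGen K) x y) : x = y := by
  cases h with
  | v_ne i j h | ck1_ne i j h =>
    ext k l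
    simp [lineRepGen, Finsupp.single_apply, h]
  | ck2 i hfin hne =>
    have hs : hfin.toFinset = {i} := by ext e; simp [lineGraphZ]
    rw [hs, Finset.sum_singleton]
    ext k l
    simp [lineRepGen]
  | _ =>
    ext k l
    simp [lineRepGen, lineGraphZ]

/-- The representation of `L_K(A_ℤ)` by finitary matrices. -/
noncomputable def lineRep : L →ₙₐ[K] Module.End K (ℤ →₀ K) :=
  lift (lineRepGen K) (lineRepGen_rel K)

theorem lineRep_vertex (i : ℤ) :
    lineRep K (vx i) = Finsupp.lsingle i ∘ₗ Finsupp.lapply i :=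
  lift_gen _ _ _

/-- The `i`-th diagonal entry of an element of `L_K(A_ℤ)`. -/
noncomputable def lineDiag (i : ℤ) : L →ₗ[K] K :=
  Finsupp.lapply i ∘ₗ LinearMap.applyₗ (Finsupp.single i (1 : K)) ∘ₗ
    (lineRep K : L →ₗ[K] Module.End K (ℤ →₀ K))

theorem lineDiag_apply (i : ℤ) (x : L) :
    lineDiag K i x = lineRep K x (Finsupp.single i (1 : K)) i := rfl

theorem lineDiag_vertex (i : ℤ) : lineDiag K i (vx i) = 1 := by
  simp [lineDiag_apply, lineRep_vertex]

theorem lineDiag_corner (i : ℤ) (x : L) : lineDiag K i (vx i * x * vx i) = lineDiag K i x := by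
  simp [lineDiag_apply, lineRep_vertex]

/-- The entry depends only on the corner v_i x v_i, which is a scalar multiple of the self-adjoint
v_i. How the involution acts in the representation is not needed. -/
theorem lineDiag_star (i : ℤ) (x : L) : lineDiag K i (star x) = lineDiag K i x := by
  obtain ⟨k, hk⟩ := (isSpanningMatrixUnits_lineUnit K).exists_corner x i i
  rw [lineUnit_self] at hk
  rw [← lineDiag_corner, ← lineDiag_corner K i x, hk, ← star_vertex, ← star_mul, ← star_mul,
    ← mul_assoc, hk, star_smul_eq]

theorem lineDiag_eq_zero_of_mem_commutatorSpan (i : ℤ) {x : L}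
    (hx : x ∈ commutatorSpan K (skewAdjoint L : Set L)) : lineDiag K i x = 0 := by
  suffices h : commutatorSpan K (skewAdjoint L : Set L) ≤ LinearMap.ker (lineDiag K i) from h hx
  refine Submodule.span_le.2 ?_
  rintro _ ⟨a, ha, b, hb, rfl⟩
  -- The two signs cancel, so the commutator is ab - (ab)*.
  have hab : star (a * b) = b * a := by
    rw [star_mul, skewAdjoint.mem_iff.1 ha, skewAdjoint.mem_iff.1 hb, neg_mul_neg]
  rw [SetLike.mem_coe, LinearMap.mem_ker, map_sub, ← hab, lineDiag_star, sub_self]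

theorem vertex_ne_zero (i : ℤ) : vx i ≠ 0 := fun h => by
  have := lineDiag_vertex K i
  rw [h, map_zero] at this
  exact zero_ne_one this

theorem vertex_notMem_commutatorSpan (i : ℤ) :
    vx i ∉ commutatorSpan K (skewAdjoint L : Set L) := fun h =>
  one_ne_zero ((lineDiag_vertex K i).symm.trans (lineDiag_eq_zero_of_mem_commutatorSpan K i h))

theorem vertex_mem_skewAdjoint [CharP K 2] (i : ℤ) : vx i ∈ skewAdjoint L := by
  rw [skewAdjoint.mem_iff, star_vertex, ← neg_one_smul K (vx i), CharTwo.neg_eq, one_smul]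

theorem isSimpleRing_line : IsSimpleRing L :=
  (isSpanningMatrixUnits_lineUnit K).isSimpleRing
    (i₀ := 0) (lineUnit_self K 0 ▸ vertex_ne_zero K 0)

theorem skewAdjoint_ne_commutatorSpan [CharP K 2] :
    (skewAdjoint L : Set L) ≠ (commutatorSpan K (skewAdjoint L : Set L) : Set L) := fun h =>
  vertex_notMem_commutatorSpan K 0 (h.subset (vertex_mem_skewAdjoint K 0))

end Line

end LeavittPathAlgebra

theorem proposition3p11 :
    -- there is a simple, locally finite Leavitt path algebra with `K_L ≠ [K_L, K_L]`
    (∃ (K : Type) (_ : Field K) (V Edge : Type) (G : DirectedGraph V Edge),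
      IsSimpleRing (LeavittPathAlgebra K G) ∧
      IsLocallyFiniteAlgebra K (LeavittPathAlgebra K G) ∧
      (skewAdjoint (LeavittPathAlgebra K G) : Set (LeavittPathAlgebra K G)) ≠
        (commutatorSpan K (skewAdjoint (LeavittPathAlgebra K G) : Set (LeavittPathAlgebra K G)) :
          Set (LeavittPathAlgebra K G))) ∧
    -- explicitly, `L_K(A_ℤ)` is an example, for each field `K` of characteristic 2
    (∀ (K : Type w) [Field K] [CharP K 2],
      IsSimpleRing (LeavittPathAlgebra K lineGraphZ) ∧
      IsLocallyFiniteAlgebra K (LeavittPathAlgebra K lineGraphZ) ∧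
      (∀ i : ℤ,
        LeavittPathAlgebra.vertex K lineGraphZ i ∈
          skewAdjoint (LeavittPathAlgebra K lineGraphZ) ∧
        LeavittPathAlgebra.vertex K lineGraphZ i ∉
          commutatorSpan K (skewAdjoint (LeavittPathAlgebra K lineGraphZ) :
            Set (LeavittPathAlgebra K lineGraphZ))) ∧
      (skewAdjoint (LeavittPathAlgebra K lineGraphZ) : Set (LeavittPathAlgebra K lineGraphZ)) ≠
        (commutatorSpan K (skewAdjoint (LeavittPathAlgebra K lineGraphZ) :
          Set (LeavittPathAlgebra K lineGraphZ)) : Set (LeavittPathAlgebra K lineGraphZ))) := by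
  refine ⟨⟨ZMod 2, inferInstance, ℤ, ℤ, lineGraphZ,
    LeavittPathAlgebra.isSimpleRing_line _,
    (LeavittPathAlgebra.isSpanningMatrixUnits_lineUnit _).isLocallyFiniteAlgebra,
    LeavittPathAlgebra.skewAdjoint_ne_commutatorSpan _⟩, fun K _ _ => ⟨
    LeavittPathAlgebra.isSimpleRing_line K,
    (LeavittPathAlgebra.isSpanningMatrixUnits_lineUnit K).isLocallyFiniteAlgebra,
    fun i => ⟨LeavittPathAlgebra.vertex_mem_skewAdjoint K i,
      LeavittPathAlgebra.vertex_notMem_commutatorSpan K i⟩,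
    LeavittPathAlgebra.skewAdjoint_ne_commutatorSpan K⟩⟩
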